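/- Let $\mathcal{E}$ be the set of all entire functions $f:\mathbb{C}\to\mathbb{C}$. Equip $\mathcal{E}$ with the topology that has as a sub-base the sets $$V_{g,\vartheta}=\Bigl\{\sum_{n\ge 0} b_nz^n\in\mathcal{E} \;:\; |a_n-b_n|<\theta_n \text{ for all } n\ge 0\Bigr\},$$ where $g(z)=\sum_{n\ge 0}a_nz^n$ ranges over $\mathcal{E}$ and $\vartheta=(\theta_n)_{n\ge 0}$ ranges over all sequences of positive real numbers. Let $\overline{\mathbb{Q}}\subseteq\mathbb{C}$ be the field of algebraic numbers. Call an entire function $f$ a Mahler function if it is transcendental (that is, the only polynomial $P\in\mathbb{C}[x,y]$ with $P(z,f(z))=0$ for all $z\in\mathbb{C}$ is $P=0$) and satisfies $f(\overline{\mathbb{Q}})\subseteq\overline{\mathbb{Q}}$ and $f^{-1}(\overline{\mathbb{Q}})\subseteq\overline{\mathbb{Q}}$. Then the set of Mahler functions is dense in $\mathcal{E}$. -/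

import Mathlib

/-- The type `ℰ` of entire functions. It is a separate type, so that it does not inherit
the topology of pointwise convergence from `ℂ → ℂ`. -/
structure EntireFunction where
  /-- The underlying function. -/
  toFun : ℂ → ℂ
  /-- The function is complex differentiable on the whole plane. -/
  differentiable : Differentiable ℂ toFun

/-- The field of algebraic numbers (the algebraic closure of `ℚ` in `ℂ`), as a subset of `ℂ`. -/
def algebraicNumbers : Set ℂ := {z : ℂ | IsAlgebraic ℚ z}

namespace EntireFunction

/-- The coefficient `aₙ` of the Taylor series `f(z) = ∑ aₙ zⁿ`. -/
noncomputable def coeff (f : EntireFunction) (n : ℕ) : ℂ :=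
  iteratedDeriv n f.toFun 0 / (n.factorial : ℂ)

/-- The set `V_{g,θ}` of all entire functions whose `n`-th Taylor coefficient is at distance
less than `θ n` from the one of `g`, for every `n`. -/
def basicOpen (g : EntireFunction) (θ : ℕ → ℝ) : Set EntireFunction :=
  {h | ∀ n, ‖g.coeff n - h.coeff n‖ < θ n}

/-- The topology on `ℰ` with sub-base the sets `V_{g,θ}`, for `g` an entire function and
`θ` a sequence of positive real numbers. -/
instance : TopologicalSpace EntireFunction :=
  TopologicalSpace.generateFrom
    {U | ∃ (g : EntireFunction) (θ : ℕ → ℝ), (∀ n, 0 < θ n) ∧ U = g.basicOpen θ}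

/-- `f` is transcendental: the only polynomial `P ∈ ℂ[x, y]` with `P(z, f(z)) = 0` for all
`z ∈ ℂ` is the zero polynomial. -/
def IsTranscendental (f : EntireFunction) : Prop :=
  ∀ P : MvPolynomial (Fin 2) ℂ, (∀ z : ℂ, MvPolynomial.eval ![z, f.toFun z] P = 0) → P = 0

/-- `f` is a Mahler function: transcendental, and both the image and the preimage of the set of
algebraic numbers consist of algebraic numbers. -/
def IsMahler (f : EntireFunction) : Prop :=
  f.IsTranscendental ∧
    f.toFun '' algebraicNumbers ⊆ algebraicNumbers ∧
    f.toFun ⁻¹' algebraicNumbers ⊆ algebraicNumbers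

end EntireFunction

/-! Enumerate the algebraic numbers as `α 0, α 1, …`. The target series is carried along as `f + P
G`, with `f`, `P` polynomials over the algebraic numbers and `G` entire and small on a disk. Later
stages change `f` only by multiples of `P`. If `P` vanishes at `α k`, the value at `α k` is
therefore frozen and algebraic. If `‖P‖ ≤ ‖f - α k‖` on the disk, then any limit within `‖P‖ / 2` of
`f` takes the value `α k` there only at zeros of `P`, which are algebraic.

To pass to the next stage (`MahlerStage.exists_refines`), approximate `G` by an algebraic polynomial
`g`, put `f' = f + P g`, and let `T` be monic with roots `α m` and all zeros of `f' - α k`, `k ≤ m`,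
in a larger disk. Dividing, `G - g = T Q + rem`, the remainder is dropped and the new `P` is `P T /
N`. Only finitely many Taylor coefficients move, and by little. The difficulty is that `T` depends
on `g`; a Jensen-type count (`exists_factor_roots_disk`) bounds its degree from the current series
alone, so the accuracy of `g` can be fixed afterwards.

Transcendence is obtained by keeping every Taylor coefficient nonzero: an algebraic entire function
has polynomial growth, hence is a polynomial. -/

open Polynomial Metric Filter Topology Complex

/-! ### Taylor coefficients of entire functions -/

/-- The `n`-th Taylor coefficient at the origin. -/
noncomputable def taylorCoeff (h : ℂ → ℂ) (n : ℕ) : ℂ := iteratedDeriv n h 0 / (n.factorial : ℂ)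

lemma taylorCoeff_add {f g : ℂ → ℂ} (hf : Differentiable ℂ f) (hg : Differentiable ℂ g) (n : ℕ) :
    taylorCoeff (fun z => f z + g z) n = taylorCoeff f n + taylorCoeff g n := by
  have := iteratedDeriv_add (n := n) (x := (0 : ℂ)) (f := f) (g := g)
    hf.contDiff.contDiffAt hg.contDiff.contDiffAt
  unfold taylorCoeff
  rw [← add_div, ← this]; rfl

lemma taylorCoeff_sub {f g : ℂ → ℂ} (hf : Differentiable ℂ f) (hg : Differentiable ℂ g) (n : ℕ) :
    taylorCoeff (fun z => f z - g z) n = taylorCoeff f n - taylorCoeff g n := by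
  have := iteratedDeriv_sub (n := n) (x := (0 : ℂ)) (f := f) (g := g)
    hf.contDiff.contDiffAt hg.contDiff.contDiffAt
  unfold taylorCoeff
  rw [← sub_div, ← this]; rfl

lemma norm_taylorCoeff_le {f : ℂ → ℂ} (hf : Differentiable ℂ f) {R C : ℝ} (hR : 0 < R)
    (hC : ∀ z, ‖z‖ = R → ‖f z‖ ≤ C) (n : ℕ) : ‖taylorCoeff f n‖ ≤ C / R ^ n := by
  have h := norm_iteratedDeriv_le_of_forall_mem_sphere_norm_le (c := 0) n hR hf.diffContOnCl
    (C := C) (fun z hz => hC z (by simpa using hz))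
  have hn : (0 : ℝ) < n.factorial := by positivity
  unfold taylorCoeff
  rw [norm_div, Complex.norm_natCast, div_le_iff₀ hn]
  calc _ ≤ _ := h
    _ = _ := by ring

lemma hasSum_taylorCoeff {f : ℂ → ℂ} (hf : Differentiable ℂ f) (z : ℂ) :
    HasSum (fun n => taylorCoeff f n * z ^ n) (f z) := by
  have h : (fun n => taylorCoeff f n * z ^ n) = fun n : ℕ =>
      (n.factorial : ℂ)⁻¹ • (z - 0) ^ n • iteratedDeriv n f 0 := by
    ext n
    simp only [taylorCoeff, sub_zero, smul_eq_mul]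
    ring
  rw [h]
  exact hasSum_taylorSeries_of_entire hf 0 z

lemma Polynomial.taylorCoeff_eval (p : ℂ[X]) (n : ℕ) :
    taylorCoeff (fun z => p.eval z) n = p.coeff n := by
  have h : ∀ n : ℕ, iteratedDeriv n (fun z => p.eval z) = fun z => (derivative^[n] p).eval z := by
    intro n
    induction n with
    | zero => simp
    | succ n ih =>
      rw [iteratedDeriv_succ, ih, Function.iterate_succ_apply']
      ext z
      simp
  have hn : (n.factorial : ℂ) ≠ 0 := by exact_mod_cast n.factorial_ne_zero
  unfold taylorCoeff
  rw [h, div_eq_iff hn]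
  beta_reduce
  rw [← coeff_zero_eq_eval_zero, coeff_iterate_derivative]
  simp [Nat.descFactorial_self, mul_comm]

/-- A sequence dominated by `1 / n!` is the sequence of Taylor coefficients of an entire
function. -/
lemma exists_entire_taylorCoeff_eq (e : ℕ → ℂ) (he : ∀ n, ‖e n‖ ≤ 1 / n.factorial) :
    ∃ E : ℂ → ℂ, Differentiable ℂ E ∧ ∀ n, taylorCoeff E n = e n := by
  set p := FormalMultilinearSeries.ofScalars ℂ e
  have hr : p.radius = ⊤ := by
    refine p.radius_eq_top_of_summable_norm fun r => ?_
    refine Summable.of_nonneg_of_le (fun n => by positivity) (fun n => ?_)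
      (Real.summable_pow_div_factorial r)
    have h1 : ‖p n‖ ≤ 1 / n.factorial :=
      (FormalMultilinearSeries.ofScalars_norm ℂ e n).le.trans (he n)
    calc ‖p n‖ * (r : ℝ) ^ n ≤ 1 / n.factorial * (r : ℝ) ^ n := by gcongr
      _ = _ := by ring
  have hp := p.hasFPowerSeriesOnBall (by rw [hr]; simp)
  rw [hr] at hp
  refine ⟨p.sum, ?_, fun n => ?_⟩
  · have := hp.differentiableOn
    rw [Metric.eball_top] at this
    exact differentiableOn_univ.1 this
  · have h := hp.factorial_smul 1 n
    rw [iteratedFDeriv_apply_eq_iteratedDeriv_mul_prod] at h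
    have hn : (n.factorial : ℂ) ≠ 0 := by exact_mod_cast n.factorial_ne_zero
    unfold taylorCoeff
    rw [div_eq_iff hn]
    simp [p, FormalMultilinearSeries.ofScalars] at h
    rw [← h]; ring

/-! ### Maximum and minimum principles, zeros on circles -/

lemma norm_le_of_norm_le_sphere {f : ℂ → ℂ} (hf : Differentiable ℂ f) {R C : ℝ} (hR : 0 < R)
    (hC : ∀ z, ‖z‖ = R → ‖f z‖ ≤ C) {z : ℂ} (hz : ‖z‖ ≤ R) : ‖f z‖ ≤ C := by
  refine norm_le_of_forall_mem_frontier_norm_le (U := ball 0 R) isBounded_ball hf.diffContOnCl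
    (fun w hw => hC w ?_) ?_
  · rw [frontier_ball 0 hR.ne'] at hw; simpa using hw
  · rw [closure_ball 0 hR.ne']; simpa using hz

/-- The minimum principle for a polynomial without zeros in a closed disk. -/
lemma Polynomial.le_norm_eval_of_le_sphere (u : ℂ[X]) {R c : ℝ} (hR : 0 < R) (hc : 0 < c)
    (h0 : ∀ z, ‖z‖ ≤ R → u.eval z ≠ 0) (hC : ∀ z, ‖z‖ = R → c ≤ ‖u.eval z‖) {z : ℂ}
    (hz : ‖z‖ ≤ R) : c ≤ ‖u.eval z‖ := by
  have h : ‖(fun w => (u.eval w)⁻¹) z‖ ≤ c⁻¹ := by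
    refine norm_le_of_forall_mem_frontier_norm_le (f := fun w => (u.eval w)⁻¹) (U := ball 0 R) isBounded_ball
      ⟨fun w hw => ?_, ?_⟩ (fun w hw => ?_) ?_
    · exact (u.differentiable.differentiableAt.inv
        (h0 w (by simpa using (mem_ball_zero_iff.1 hw).le))).differentiableWithinAt
    · rw [closure_ball 0 hR.ne']
      exact u.continuous.continuousOn.inv₀ fun w hw => h0 w (by simpa using hw)
    · rw [frontier_ball 0 hR.ne'] at hw
      simp only [norm_inv]
      gcongr
      exact hC w (by simpa using hw)
    · rw [closure_ball 0 hR.ne']; simpa using hz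
  simp only [norm_inv] at h
  exact (inv_le_inv₀ (norm_pos_iff.2 (h0 z hz)) hc).1 h

/-- An entire function is bounded on every disk. -/
lemma exists_norm_le_of_differentiable {f : ℂ → ℂ} (hf : Differentiable ℂ f) (R : ℝ) :
    ∃ C : ℝ, 0 < C ∧ ∀ z, ‖z‖ ≤ R → ‖f z‖ ≤ C := by
  obtain ⟨C, hC⟩ := (isCompact_closedBall (0 : ℂ) R).exists_bound_of_continuousOn
    hf.continuous.continuousOn
  exact ⟨max C 1, by positivity, fun z hz => (hC z (by simpa using hz)).trans (le_max_left _ _)⟩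

/-- Nonconstant entire functions are nonzero on suitable circles. -/
lemma exists_radius_forall_ne_zero {ι : Type*} (s : Finset ι) (h : ι → ℂ → ℂ)
    (hd : ∀ i, Differentiable ℂ (h i)) (h0 : ∀ i, ∃ z, h i z ≠ 0) (R : ℝ) :
    ∃ R', R ≤ R' ∧ ∀ i ∈ s, ∀ z, ‖z‖ = R' → h i z ≠ 0 := by
  have hfin : ∀ i, {z : ℂ | ‖z‖ ≤ R + 1 ∧ h i z = 0}.Finite := by
    intro i
    obtain ⟨x, hx⟩ := h0 i
    have ha : AnalyticOnNhd ℂ (h i) Set.univ := fun z _ => (hd i).analyticAt z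
    have h1 := ha.preimage_zero_mem_codiscrete hx
    have h2 := (isCompact_closedBall (0 : ℂ) (R + 1)).finite_sdiff_of_mem_codiscreteWithin
      (codiscreteWithin_mono (Set.subset_univ _) h1)
    refine h2.subset fun z hz => ?_
    simpa using hz
  have hf2 : (⋃ i ∈ s, norm '' {z : ℂ | ‖z‖ ≤ R + 1 ∧ h i z = 0}).Finite :=
    s.finite_toSet.biUnion fun i _ => (hfin i).image _
  obtain ⟨r, hr, hr'⟩ := (Set.Icc_infinite (show R < R + 1 by linarith)).exists_notMem_finite hf2
  refine ⟨r, hr.1, fun i hi z hz hz0 => hr' ?_⟩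
  simp only [Set.mem_iUnion]
  exact ⟨i, hi, z, ⟨hz.le.trans hr.2, hz0⟩, hz⟩

/-- A finite family of continuous functions without zeros on a compact set is bounded away from
zero there. -/
lemma exists_pos_le_norm {ι : Type*} (s : Finset ι) (h : ι → ℂ → ℂ)
    (hd : ∀ i, Continuous (h i)) (K : Set ℂ) (hK : IsCompact K)
    (h0 : ∀ i ∈ s, ∀ z ∈ K, h i z ≠ 0) :
    ∃ c : ℝ, 0 < c ∧ ∀ i ∈ s, ∀ z ∈ K, c ≤ ‖h i z‖ := by
  classical
  induction s using Finset.induction_on with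
  | empty => exact ⟨1, one_pos, by simp⟩
  | insert i s hi ih =>
    obtain ⟨c, hc, hc'⟩ := ih fun j hj => h0 j (Finset.mem_insert_of_mem hj)
    rcases K.eq_empty_or_nonempty with rfl | hne
    · exact ⟨1, one_pos, by simp⟩
    obtain ⟨x, hx, hx'⟩ := hK.exists_isMinOn hne (hd i).norm.continuousOn
    refine ⟨min c ‖h i x‖, lt_min hc (norm_pos_iff.2 (h0 i (by simp) x hx)), fun j hj z hz => ?_⟩
    rcases Finset.mem_insert.1 hj with rfl | hj
    · exact (min_le_right _ _).trans (hx' hz)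
    · exact (min_le_left _ _).trans (hc' j hj z hz)

/-! ### Polynomials with algebraic coefficients and approximation by them -/

/-- The polynomials with algebraic coefficients. -/
noncomputable def algebraicPolynomials : Subsemiring ℂ[X] :=
  Polynomial.lifts (algebraMap (algebraicClosure ℚ ℂ) ℂ)

lemma C_mem_algebraicPolynomials {a : ℂ} (ha : a ∈ algebraicNumbers) :
    C a ∈ algebraicPolynomials :=
  C_mem_lifts (algebraMap (algebraicClosure ℚ ℂ) ℂ) ⟨a, mem_algebraicClosure_iff.2 ha⟩

lemma X_sub_C_mem_algebraicPolynomials {a : ℂ} (ha : a ∈ algebraicNumbers) :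
    X - C a ∈ algebraicPolynomials := by
  rw [sub_eq_add_neg, ← C_neg]
  exact add_mem (X_mem_lifts _) (C_mem_algebraicPolynomials (IsAlgebraic.neg ha))

lemma eval_mem_algebraicNumbers {p : ℂ[X]} (hp : p ∈ algebraicPolynomials) {a : ℂ}
    (ha : a ∈ algebraicNumbers) : p.eval a ∈ algebraicNumbers := by
  obtain ⟨q, rfl⟩ := hp
  have h : (map (algebraMap (algebraicClosure ℚ ℂ) ℂ) q).eval a
      = algebraMap _ ℂ (q.eval ⟨a, mem_algebraicClosure_iff.2 ha⟩) := by
    rw [← eval₂_at_apply, eval_map]; rfl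
  rw [coe_mapRingHom, h]
  have h2 := (q.eval ⟨a, mem_algebraicClosure_iff.2 ha⟩).2
  exact mem_algebraicClosure_iff.1 h2

lemma mem_algebraicNumbers_of_eval_eq_zero {p : ℂ[X]} (hp : p ∈ algebraicPolynomials)
    (h0 : p ≠ 0) {z : ℂ} (hz : p.eval z = 0) : z ∈ algebraicNumbers := by
  obtain ⟨q, rfl⟩ := hp
  have h : IsAlgebraic (algebraicClosure ℚ ℂ) z := by
    refine ⟨q, fun hq => h0 (by simp [hq]), ?_⟩
    rwa [coe_mapRingHom, eval_map_algebraMap] at hz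
  have : Algebra.IsAlgebraic ℚ (algebraicClosure ℚ ℂ) := by
    convert algebraicClosure.isAlgebraic ℚ ℂ
    · rfl
    · exact Subsingleton.elim _ _
  exact h.restrictScalars ℚ

lemma prod_X_sub_C_mem_algebraicPolynomials {s : Multiset ℂ} (hs : ∀ a ∈ s, a ∈ algebraicNumbers) :
    (s.map fun a => X - C a).prod ∈ algebraicPolynomials := by
  refine multiset_prod_mem _ fun p hp => ?_
  obtain ⟨a, ha, rfl⟩ := Multiset.mem_map.1 hp
  exact X_sub_C_mem_algebraicPolynomials (hs a ha)

lemma exists_algebraicNumbers_norm_sub_lt (z : ℂ) {ε : ℝ} (hε : 0 < ε) :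
    ∃ a ∈ algebraicNumbers, ‖z - a‖ < ε := by
  obtain ⟨x, hx, hx'⟩ := exists_rat_btwn (show z.re - ε / 2 < z.re by linarith)
  obtain ⟨y, hy, hy'⟩ := exists_rat_btwn (show z.im - ε / 2 < z.im by linarith)
  refine ⟨(x : ℂ) + (y : ℂ) * I, ?_, ?_⟩
  · have hI : IsAlgebraic ℚ I := by
      refine ⟨X ^ 2 + 1, ?_, by simp⟩
      exact (monic_X_pow_add_C (1 : ℚ) two_ne_zero).ne_zero
    exact (isAlgebraic_algebraMap (A := ℂ) x).add ((isAlgebraic_algebraMap (A := ℂ) y).mul hI)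
  · refine (norm_le_abs_re_add_abs_im _).trans_lt ?_
    have h1 : |(z - ((x : ℂ) + (y : ℂ) * I)).re| < ε / 2 := by
      simp [abs_lt]; constructor <;> linarith
    have h2 : |(z - ((x : ℂ) + (y : ℂ) * I)).im| < ε / 2 := by
      simp [abs_lt]; constructor <;> linarith
    linarith

lemma exists_range_eq_algebraicNumbers : ∃ α : ℕ → ℂ, Set.range α = algebraicNumbers := by
  obtain ⟨α, h⟩ := (Algebraic.countable ℚ ℂ).exists_eq_range ⟨0, isAlgebraic_zero⟩
  exact ⟨α, h.symm⟩

lemma exists_algebraicPolynomials_approx (p : ℂ[X]) (R : ℝ) {δ : ℝ} (hδ : 0 < δ) :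
    ∃ q ∈ algebraicPolynomials, ∀ z, ‖z‖ ≤ R → ‖p.eval z - q.eval z‖ < δ := by
  induction p using Polynomial.induction_on' generalizing δ with
  | add p q hp hq =>
    obtain ⟨p', hp', h1⟩ := hp (half_pos hδ)
    obtain ⟨q', hq', h2⟩ := hq (half_pos hδ)
    refine ⟨p' + q', add_mem hp' hq', fun z hz => ?_⟩
    have := h1 z hz
    have := h2 z hz
    calc ‖(p + q).eval z - (p' + q').eval z‖
        = ‖(p.eval z - p'.eval z) + (q.eval z - q'.eval z)‖ := by simp; ring_nf
      _ ≤ _ := norm_add_le _ _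
      _ < δ := by linarith
  | monomial n a =>
    have hR : 0 < (|R| + 1) ^ n := by positivity
    obtain ⟨b, hb, hab⟩ := exists_algebraicNumbers_norm_sub_lt a (div_pos hδ hR)
    refine ⟨C b * X ^ n, mul_mem (C_mem_algebraicPolynomials hb) (pow_mem (X_mem_lifts _) n),
      fun z hz => ?_⟩
    have hz' : ‖z‖ ^ n ≤ (|R| + 1) ^ n := by
      gcongr
      linarith [le_abs_self R]
    rw [lt_div_iff₀ hR] at hab
    calc ‖(monomial n a).eval z - (C b * X ^ n).eval z‖ = ‖a - b‖ * ‖z‖ ^ n := by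
          rw [← norm_pow, ← norm_mul]; simp [sub_mul]
      _ ≤ ‖a - b‖ * (|R| + 1) ^ n := by gcongr
      _ < δ := hab

/-- Entire functions are approximated on disks by polynomials with algebraic coefficients. -/
lemma exists_algebraicPolynomials_approx_entire {G : ℂ → ℂ} (hG : Differentiable ℂ G) (R : ℝ)
    {δ : ℝ} (hδ : 0 < δ) :
    ∃ q ∈ algebraicPolynomials, ∀ z, ‖z‖ ≤ R → ‖G z - q.eval z‖ < δ := by
  set r := |R| + 1 with hr
  have hr0 : 0 < r := by positivity
  have hs : Summable fun n => ‖taylorCoeff G n‖ * r ^ n := by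
    have := (hasSum_taylorCoeff hG r).summable.norm
    simpa [abs_of_pos hr0] using this
  have hu := tendstoUniformlyOn_tsum_nat (f := fun n z => taylorCoeff G n * z ^ n) hs
    (s := {z : ℂ | ‖z‖ ≤ R}) fun n z hz => by
      have hz' : ‖z‖ ≤ R := hz
      rw [norm_mul, norm_pow]
      gcongr
      linarith [le_abs_self R]
  obtain ⟨N, hN⟩ := (Metric.tendstoUniformlyOn_iff.1 hu (δ / 2) (half_pos hδ)).exists
  obtain ⟨q, hq, hpq⟩ := exists_algebraicPolynomials_approx
    (∑ n ∈ Finset.range N, C (taylorCoeff G n) * X ^ n) R (half_pos hδ)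
  refine ⟨q, hq, fun z hz => ?_⟩
  have h1 := hN z hz
  have h2 := hpq z hz
  rw [(hasSum_taylorCoeff hG z).tsum_eq, dist_eq_norm] at h1
  simp only [eval_finsetSum, eval_mul, eval_C, eval_pow, eval_X] at h2
  calc ‖G z - q.eval z‖ ≤ _ := norm_sub_le_norm_sub_add_norm_sub _ _ _
    _ < δ := by linarith

/-! ### Quantitative division and zero counting -/

lemma norm_eval_prod_X_sub_C_le {s : Multiset ℂ} {ρ : ℝ} (hs : ∀ a ∈ s, ‖a‖ ≤ ρ) {z : ℂ} {B : ℝ}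
    (hB : ‖z‖ + ρ ≤ B) : ‖((s.map fun a => X - C a).prod).eval z‖ ≤ B ^ s.card := by
  induction s using Multiset.induction_on with
  | empty => simp
  | cons a s ih =>
    have h1 := ih fun b hb => hs b (Multiset.mem_cons_of_mem hb)
    have h2 : ‖z - a‖ ≤ B := (norm_sub_le z a).trans (by linarith [hs a (by simp)])
    simp only [Multiset.map_cons, Multiset.prod_cons, eval_mul, norm_mul, Multiset.card_cons,
      eval_sub, eval_X, eval_C, pow_succ']
    gcongr
    exact (norm_nonneg _).trans h2

lemma le_norm_eval_prod_X_sub_C {s : Multiset ℂ} {ρ : ℝ} (hs : ∀ a ∈ s, ‖a‖ ≤ ρ) {z : ℂ} {b : ℝ}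
    (hb0 : 0 ≤ b) (hb : b ≤ ‖z‖ - ρ) : b ^ s.card ≤ ‖((s.map fun a => X - C a).prod).eval z‖ := by
  induction s using Multiset.induction_on with
  | empty => simp
  | cons a s ih =>
    have h1 := ih fun b hb => hs b (Multiset.mem_cons_of_mem hb)
    have h2 : b ≤ ‖z - a‖ := le_trans (by linarith [hs a (by simp)]) (norm_sub_norm_le z a)
    simp only [Multiset.map_cons, Multiset.prod_cons, eval_mul, norm_mul, Multiset.card_cons,
      eval_sub, eval_X, eval_C, pow_succ']
    gcongr

/-- Division with remainder of an entire function by a polynomial whose roots lie in the disk of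
radius `ρ`, with bounds for quotient and remainder. -/
lemma exists_div_prod_X_sub_C (s : Multiset ℂ) {ρ : ℝ} (hρ : 0 ≤ ρ) (hs : ∀ a ∈ s, ‖a‖ ≤ ρ)
    {H : ℂ → ℂ} (hH : Differentiable ℂ H) {δ : ℝ} (hδ : ∀ z, ‖z‖ ≤ ρ + 1 → ‖H z‖ ≤ δ) :
    ∃ (Q : ℂ → ℂ) (rem : ℂ[X]), Differentiable ℂ Q ∧
      (∀ z, H z = ((s.map fun a => X - C a).prod).eval z * Q z + rem.eval z) ∧
      rem.natDegree ≤ s.card ∧ ∀ z, ‖z‖ ≤ ρ + 1 → ‖Q z‖ ≤ 2 ^ s.card * δ := by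
  induction s using Multiset.induction_on generalizing H δ with
  | empty => exact ⟨H, 0, hH, by simp, by simp, by simpa using hδ⟩
  | cons a s ih =>
    have ha : ‖a‖ ≤ ρ := hs a (by simp)
    have hd : Differentiable ℂ (dslope H a) := by
      rw [← differentiableOn_univ, differentiableOn_dslope univ_mem]
      exact hH.differentiableOn
    have hmul : ∀ z, (z - a) * dslope H a z = H z - H a := fun z => by
      simpa using sub_smul_dslope H a z
    have hb : ∀ z, ‖z‖ ≤ ρ + 1 → ‖dslope H a z‖ ≤ 2 * δ := by
      intro z hz
      -- By the maximum principle only the circle of radius `ρ + 1` matters, and there `w` is at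
      -- distance at least 1 from `a`.
      refine norm_le_of_norm_le_sphere hd (R := ρ + 1) (by linarith) (fun w hw => ?_) hz
      have h1 : 1 ≤ ‖w - a‖ := le_trans (by linarith) (norm_sub_norm_le w a)
      calc ‖dslope H a w‖ ≤ ‖w - a‖ * ‖dslope H a w‖ :=
            le_mul_of_one_le_left (norm_nonneg _) h1
        _ = ‖H w - H a‖ := by rw [← norm_mul, hmul]
        _ ≤ ‖H w‖ + ‖H a‖ := norm_sub_le _ _
        _ ≤ 2 * δ := by linarith [hδ w hw.le, hδ a (by linarith)]
    obtain ⟨Q, rem, hQ, hdiv, hdeg, hbd⟩ :=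
      ih (fun b hb => hs b (Multiset.mem_cons_of_mem hb)) hd hb
    refine ⟨Q, (X - C a) * rem + C (H a), hQ, fun z => ?_, ?_, fun z hz => ?_⟩
    · have h1 := hmul z
      rw [hdiv z] at h1
      simp only [Multiset.map_cons, Multiset.prod_cons, eval_mul, eval_add, eval_sub, eval_X,
        eval_C]
      linear_combination -h1
    · rw [natDegree_add_C, Multiset.card_cons]
      refine natDegree_mul_le.trans ?_
      rw [natDegree_X_sub_C]
      omega
    · refine (hbd z hz).trans_eq ?_
      rw [Multiset.card_cons, pow_succ]; ring

/-- A polynomial that is bounded above on a large disk and below on the circle of radius `R` has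
boundedly many zeros in the disk of radius `R`, and the cofactor of these zeros is bounded
below. -/
lemma exists_factor_roots_disk (h : ℂ[X]) {R c S : ℝ} (hR : 1 ≤ R) (hc : 0 < c) {D : ℕ}
    (hS : ∀ z, ‖z‖ ≤ 4 * R → ‖h.eval z‖ ≤ S) (hcR : ∀ z, ‖z‖ = R → c ≤ ‖h.eval z‖)
    (hD : (2 / 3 : ℝ) ^ D * S < c) :
    ∃ (s : Multiset ℂ) (u : ℂ[X]), h = (s.map fun a => X - C a).prod * u ∧
      (∀ a ∈ s, h.eval a = 0 ∧ ‖a‖ ≤ R) ∧ s.card ≤ D ∧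
      ∀ z, ‖z‖ ≤ R → c / (2 * R) ^ D ≤ ‖u.eval z‖ := by
  classical
  have hR0 : 0 < R := by linarith
  have hRn : ‖((R : ℝ) : ℂ)‖ = R := by simp [abs_of_pos hR0]
  have hh : h ≠ 0 := by
    rintro rfl
    have := hcR R hRn
    simp at this; linarith
  set s := h.roots.filter (fun a => ‖a‖ ≤ R) with hs
  have hsR : ∀ a ∈ s, ‖a‖ ≤ R := fun a ha => (Multiset.mem_filter.1 ha).2
  obtain ⟨u, hu⟩ : (s.map fun a => X - C a).prod ∣ h :=
    (Multiset.prod_dvd_prod_of_le (Multiset.map_le_map (Multiset.filter_le _ _))).trans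
      (prod_multiset_X_sub_C_dvd h)
  set p := (s.map fun a => X - C a).prod with hp
  have hev : ∀ z, ‖h.eval z‖ = ‖p.eval z‖ * ‖u.eval z‖ := fun z => by
    rw [← norm_mul, ← eval_mul, ← hu]
  have hu0 : ∀ z, ‖z‖ ≤ R → u.eval z ≠ 0 := by
    intro z hz huz
    have hne : p * u ≠ 0 := hu ▸ hh
    have hr : h.roots = s + u.roots := by
      rw [hu, roots_mul hne, hp, roots_multiset_prod_X_sub_C]
    have h1 : z ∈ u.roots := (mem_roots (right_ne_zero_of_mul hne)).2 huz
    have h2 := congrArg (Multiset.filter (fun a => ‖a‖ ≤ R)) hr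
    rw [Multiset.filter_add, ← hs, Multiset.filter_eq_self.2 hsR] at h2
    have h3 : Multiset.filter (fun a => ‖a‖ ≤ R) u.roots = 0 := by
      simpa using h2
    have : z ∈ Multiset.filter (fun a => ‖a‖ ≤ R) u.roots := Multiset.mem_filter.2 ⟨h1, hz⟩
    rw [h3] at this
    simp at this
  have hS0 : 0 < S := hc.trans_le ((hcR R hRn).trans (hS R (by rw [hRn]; linarith)))
  -- Jensen-type count: on the circle of radius `4 * R` each factor of `p` is at least `3 * R`, at
  -- the point `R` at most `2 * R`. Applying the maximum principle to `u` gives `c ≤ (2 / 3) ^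
  -- s.card * S`.
  have hcard : s.card ≤ D := by
    have hup : ‖u.eval (R : ℂ)‖ ≤ S / (3 * R) ^ s.card := by
      refine norm_le_of_norm_le_sphere u.differentiable (R := 4 * R) (by linarith) (fun z hz => ?_)
        (by rw [hRn]; linarith)
      rw [le_div_iff₀ (by positivity), mul_comm]
      calc (3 * R) ^ s.card * ‖u.eval z‖ ≤ ‖p.eval z‖ * ‖u.eval z‖ := by
            gcongr
            exact le_norm_eval_prod_X_sub_C hsR (by linarith) (by rw [hz]; linarith)
        _ ≤ S := by rw [← hev]; exact hS z hz.le
    have hcS : c ≤ (2 / 3 : ℝ) ^ s.card * S := by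
      calc c ≤ ‖p.eval (R : ℂ)‖ * ‖u.eval (R : ℂ)‖ := by rw [← hev]; exact hcR R hRn
        _ ≤ (2 * R) ^ s.card * (S / (3 * R) ^ s.card) := by
            gcongr
            exact norm_eval_prod_X_sub_C_le hsR (by rw [hRn]; linarith)
        _ = ((2 * R) / (3 * R)) ^ s.card * S := by rw [div_pow]; ring
        _ = _ := by rw [mul_div_mul_right _ _ hR0.ne']
    by_contra! hlt
    have : (2 / 3 : ℝ) ^ s.card ≤ (2 / 3 : ℝ) ^ D :=
      pow_le_pow_of_le_one (by norm_num) (by norm_num) hlt.le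
    nlinarith
  refine ⟨s, u, hu, fun a ha => ⟨?_, hsR a ha⟩, hcard, fun z hz => ?_⟩
  · exact (mem_roots hh).1 (Multiset.mem_filter.1 ha).1
  · refine u.le_norm_eval_of_le_sphere hR0 (by positivity) hu0 (fun w hw => ?_) hz
    rw [div_le_iff₀ (by positivity)]
    calc c ≤ ‖p.eval w‖ * ‖u.eval w‖ := by rw [← hev]; exact hcR w hw
      _ ≤ (2 * R) ^ s.card * ‖u.eval w‖ := by
          gcongr
          exact norm_eval_prod_X_sub_C_le hsR (by rw [hw]; linarith)
      _ ≤ (2 * R) ^ D * ‖u.eval w‖ := by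
          gcongr
          linarith
      _ = _ := mul_comm _ _

/-! ### The inductive construction -/

/-- An approximation `f + P G` of the power series with coefficients `a`, for which the polynomial
`f` takes the first `m` values of `α` in a disk only in a way that is controlled by `P`. -/
structure MahlerStage (α a : ℕ → ℂ) (θ : ℕ → ℝ) (m : ℕ) where
  f : ℂ[X]
  P : ℂ[X]
  G : ℂ → ℂ
  R : ℝ
  f_mem : f ∈ algebraicPolynomials
  P_mem : P ∈ algebraicPolynomials
  P_ne_zero : P ≠ 0
  G_diff : Differentiable ℂ G
  one_le_R : 1 ≤ R
  le_R : (m : ℝ) ≤ R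
  eval_P : ∀ k < m, P.eval (α k) = 0
  norm_P_le : ∀ k < m, ∀ z, ‖z‖ ≤ R → ‖P.eval z‖ ≤ ‖f.eval z - α k‖
  norm_G_le : ∀ z, ‖z‖ ≤ R → ‖G z‖ ≤ (1 / 2) ^ (m + 3)
  -- The factor `1 - (1 / 2) ^ m` leaves room for an error `θ n * (1 / 2) ^ (m + 1)` at the next
  -- stage.
  coeff_le : ∀ n, ‖taylorCoeff (fun z => f.eval z + P.eval z * G z) n - a n‖
    ≤ θ n * (1 - (1 / 2) ^ m)

/-- The relation between consecutive approximations. -/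
structure MahlerStage.Refines {α a : ℕ → ℂ} {θ : ℕ → ℝ} {m : ℕ} (s : MahlerStage α a θ m)
    (t : MahlerStage α a θ (m + 1)) : Prop where
  R_le : s.R ≤ t.R
  P_le : ∀ z, ‖z‖ ≤ s.R → ‖t.P.eval z‖ ≤ ‖s.P.eval z‖
  f_le : ∀ z, ‖z‖ ≤ s.R → ‖t.f.eval z - s.f.eval z‖ ≤ ‖s.P.eval z‖ * (1 / 2) ^ (m + 2)

lemma exists_pos_mul_le (C d : ℝ) (hC : 0 < C) (hd : 0 < d) : ∃ δ > 0, δ * C ≤ d :=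
  ⟨d / C, by positivity, by rw [div_mul_cancel₀ _ hC.ne']⟩

-- The order of choices is what makes this work: `R'`, `c`, `S`, `D`, `e`, `B`, `M`, `N`, `μ` depend
-- only on the current stage, then `δ` on all of them, and only then are `g`, the zeros of `f' - α
-- k` and `T` produced.
set_option maxHeartbeats 1600000 in
lemma MahlerStage.exists_refines {α a : ℕ → ℂ} {θ : ℕ → ℝ} {m : ℕ}
    (hα : ∀ k, α k ∈ algebraicNumbers) (hθ : ∀ n, 0 < θ n) (hθa : θ 1 ≤ ‖a 1‖)
    (s : MahlerStage α a θ m) : ∃ t : MahlerStage α a θ (m + 1), s.Refines t := by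
  obtain ⟨f, P, G, R, hf, hP, hP0, hG, hR1, hRm, hPα, hPle, hGle, hcoeff⟩ := s
  set F : ℂ → ℂ := fun z => f.eval z + P.eval z * G z with hF
  have hFd : Differentiable ℂ F := f.differentiable.add (P.differentiable.mul hG)
  -- `F` is not constant: its linear coefficient differs from `a 1` by less than `θ 1 ≤ ‖a 1‖`.
  have hFα : ∀ k, ∃ z, F z - α k ≠ 0 := by
    intro k
    by_contra! h
    have h1 : F = fun z => (C (α k)).eval z := by
      ext z; simpa [sub_eq_zero] using h z
    have h2 := hcoeff 1
    rw [h1, Polynomial.taylorCoeff_eval, coeff_C_of_ne_zero one_ne_zero, zero_sub, norm_neg] at h2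
    have h3 : (0 : ℝ) < (1 / 2) ^ m := by positivity
    nlinarith [hθ 1]
  obtain ⟨R', hRR', hR'⟩ := exists_radius_forall_ne_zero (Finset.range (m + 1))
    (fun k z => F z - α k) (fun k => hFd.sub_const _) hFα (R + 1)
  obtain ⟨c₀, hc₀, hc₀F⟩ := exists_pos_le_norm (Finset.range (m + 1))
    (fun k z => F z - α k) (fun k => (hFd.sub_const _).continuous) (sphere 0 R')
    (isCompact_sphere 0 R') (fun k hk z hz => hR' k hk z (by simpa using hz))
  -- Half of the lower bound is given up when `F` is replaced by `f'`; likewise the `+ 1` in `S`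
  -- below.
  obtain ⟨c, hc, rfl⟩ : ∃ c : ℝ, 0 < c ∧ c₀ = 2 * c := ⟨c₀ / 2, by positivity, by ring⟩
  set A : ℝ := ∑ k ∈ Finset.range (m + 1), ‖α k‖ with hA
  have hA0 : 0 ≤ A := Finset.sum_nonneg fun _ _ => norm_nonneg _
  have hαA : ∀ k < m + 1, ‖α k‖ ≤ A := fun k hk =>
    Finset.single_le_sum (f := fun k => ‖α k‖) (fun _ _ => norm_nonneg _)
      (Finset.mem_range.2 hk)
  obtain ⟨S₀, hS₀, hS₀F⟩ := exists_norm_le_of_differentiable hFd (4 * R')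
  set S : ℝ := S₀ + 1 + A with hS
  have hSpos : 0 < S := by positivity
  obtain ⟨D, hD⟩ := exists_pow_lt_of_lt_one (div_pos hc hSpos) (show (2 / 3 : ℝ) < 1 by norm_num)
  rw [lt_div_iff₀ hSpos] at hD
  set ρ : ℝ := R' + A with hρ
  have hρ1 : 1 ≤ ρ := by linarith
  -- At most `D` zeros for each of `m + 1` values, and one more root for `α m`.
  set e : ℕ := (m + 1) * D + 1 with he
  set B : ℝ := (2 * ρ) ^ e with hB
  have hB0 : 0 < B := by positivity
  obtain ⟨M, hM0, hMP⟩ := exists_norm_le_of_differentiable P.differentiable (4 * R' + ρ + 1)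
  have hR'0 : 0 < R' := by linarith
  -- `B ≤ N` will give `‖P T / N‖ ≤ ‖P‖` on the old disk; the last summand gives `‖P T / N‖ ≤ ‖f' -
  -- α k‖` on the new one.
  obtain ⟨N, hN⟩ := exists_nat_ge (1 + B + M * B * (2 * R') ^ D / c)
  have hNx : 0 ≤ M * B * (2 * R') ^ D / c := by positivity
  have hN1 : 1 ≤ (N : ℝ) := by linarith
  have hNB : B ≤ N := by linarith
  have hNM : M * B * (2 * R') ^ D / c ≤ N := by linarith
  obtain ⟨μ, hμ, hμθ⟩ : ∃ μ > 0, ∀ n ≤ P.natDegree + e, μ ≤ θ n := by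
    refine ⟨(Finset.range (P.natDegree + e + 1)).inf' ⟨0, by simp⟩ θ,
      (Finset.lt_inf'_iff _).2 fun n _ => hθ n, fun n hn => Finset.inf'_le _ ?_⟩
    exact Finset.mem_range.2 (by omega)
  obtain ⟨δ, hδ, hδle⟩ := exists_pos_mul_le (1 + M + 2 ^ e * N + M * (1 + B * 2 ^ e))
    (min (min ((1 / 2) ^ (m + 4)) (min c 1)) (μ * (1 / 2) ^ (m + 1)))
    (by positivity) (by positivity)
  rw [show δ * (1 + M + 2 ^ e * N + M * (1 + B * 2 ^ e)) =
    δ + δ * M + δ * (2 ^ e * N) + δ * (M * (1 + B * 2 ^ e)) by ring] at hδle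
  have hδ' := le_min_iff.1 hδle
  have hδ'' := le_min_iff.1 hδ'.1
  have hδ3 := le_min_iff.1 hδ''.2
  have hx1 : 0 ≤ δ * M := by positivity
  have hx2 : 0 ≤ δ * (2 ^ e * N) := by positivity
  have hx3 : 0 ≤ δ * (M * (1 + B * 2 ^ e)) := by positivity
  have hd1 : δ ≤ (1 / 2) ^ (m + 3) := by
    have : (1 / 2 : ℝ) ^ (m + 4) ≤ (1 / 2) ^ (m + 3) :=
      pow_le_pow_of_le_one (by norm_num) (by norm_num) (by omega)
    linarith [hδ''.1]
  have hd2 : δ * M ≤ c := by linarith [hδ3.1]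
  have hd3 : δ * M ≤ 1 := by linarith [hδ3.2]
  have hd4 : δ * (2 ^ e * N) ≤ (1 / 2) ^ (m + 4) := by linarith [hδ''.1]
  have hd5 : δ * (M * (1 + B * 2 ^ e)) ≤ μ * (1 / 2) ^ (m + 1) := by linarith [hδ'.2]
  clear hδle hδ' hδ'' hδ3 hx1 hx2 hx3 hN hNx
  obtain ⟨g, hg, hgG⟩ := exists_algebraicPolynomials_approx_entire hG (4 * R' + ρ + 1) hδ
  set f' : ℂ[X] := f + P * g with hf'
  have hf'mem : f' ∈ algebraicPolynomials := add_mem hf (mul_mem hP hg)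
  have hf'F : ∀ z, ‖z‖ ≤ 4 * R' → ‖f'.eval z - F z‖ ≤ δ * M := by
    intro z hz
    have h1 := hMP z (by linarith)
    have h2 := hgG z (by linarith)
    calc ‖f'.eval z - F z‖ = ‖G z - g.eval z‖ * ‖P.eval z‖ := by
          rw [← norm_mul, ← norm_neg]; congr 1; simp [hf', hF]; ring
      _ ≤ δ * M := by gcongr
  have hfac : ∀ k, k < m + 1 → ∃ (s : Multiset ℂ) (u : ℂ[X]),
      f' - C (α k) = (s.map fun a => X - C a).prod * u ∧
      (∀ a ∈ s, (f' - C (α k)).eval a = 0 ∧ ‖a‖ ≤ R') ∧ s.card ≤ D ∧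
      ∀ z, ‖z‖ ≤ R' → c / (2 * R') ^ D ≤ ‖u.eval z‖ := by
    intro k hk
    refine exists_factor_roots_disk _ (by linarith) hc (S := S) (fun z hz => ?_) (fun z hz => ?_) hD
    · have h1 := hf'F z hz
      have h2 := hS₀F z hz
      have h3 := hαA k hk
      have h4 : (f' - C (α k)).eval z = (f'.eval z - F z) + F z - α k := by simp
      rw [h4]
      refine (norm_sub_le _ _).trans ?_
      have := norm_add_le (f'.eval z - F z) (F z)
      linarith
    · have h1 := hf'F z (by linarith)
      have h2 := hc₀F k (Finset.mem_range.2 hk) z (by simpa using hz)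
      have h4 : F z - α k = (f' - C (α k)).eval z - (f'.eval z - F z) := by simp
      rw [h4] at h2
      have := norm_sub_le ((f' - C (α k)).eval z) (f'.eval z - F z)
      linarith
  have hne : ∀ k < m + 1, f' - C (α k) ≠ 0 := by
    intro k hk h0
    obtain ⟨s, u, h1, -, -, h2⟩ := hfac k hk
    have h3 := h2 0 (by simpa using hR'0.le)
    rw [h0] at h1
    have hu : u = 0 := by
      rcases mul_eq_zero.1 h1.symm with h | h
      · exact absurd h (monic_multiset_prod_of_monic _ _ fun a _ => monic_X_sub_C a).ne_zero
      · exact h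
    have : 0 < c / (2 * R') ^ D := by positivity
    rw [hu, eval_zero, norm_zero] at h3
    linarith
  choose! s u hsu hsroot hscard hule using hfac
  have hsalg : ∀ k < m + 1, ∀ b ∈ s k, b ∈ algebraicNumbers := by
    intro k hk b hb
    refine mem_algebraicNumbers_of_eval_eq_zero (p := f' - C (α k)) ?_ (hne k hk)
      (hsroot k hk b hb).1
    rw [sub_eq_add_neg, ← C_neg]
    exact add_mem hf'mem (C_mem_algebraicPolynomials (IsAlgebraic.neg (hα k)))
  set t : Multiset ℂ := (∑ k ∈ Finset.range (m + 1), s k) + {α m} with ht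
  have htmem : ∀ b ∈ t, b = α m ∨ ∃ k < m + 1, b ∈ s k := by
    intro b hb
    rcases Multiset.mem_add.1 hb with h | h
    · obtain ⟨k, hk, hb⟩ := Multiset.mem_sum.1 h
      exact Or.inr ⟨k, Finset.mem_range.1 hk, hb⟩
    · exact Or.inl (Multiset.mem_singleton.1 h)
  have htρ : ∀ b ∈ t, ‖b‖ ≤ ρ := by
    intro b hb
    rcases htmem b hb with rfl | ⟨k, hk, hb⟩
    · linarith [hαA m (by omega)]
    · linarith [(hsroot k hk b hb).2]
  have htalg : ∀ b ∈ t, b ∈ algebraicNumbers := by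
    intro b hb
    rcases htmem b hb with rfl | ⟨k, hk, hb⟩
    · exact hα m
    · exact hsalg k hk b hb
  have htcard : t.card ≤ e := by
    rw [ht, Multiset.card_add, Multiset.card_singleton, Multiset.card_sum, he]
    have := Finset.sum_le_card_nsmul (Finset.range (m + 1)) (fun k => (s k).card) D
      fun k hk => hscard k (Finset.mem_range.1 hk)
    simpa using this
  have hst : ∀ k < m + 1, s k ≤ t := fun k hk =>
    (Finset.single_le_sum (f := s) (fun _ _ => zero_le) (Finset.mem_range.2 hk)).trans
      (Multiset.le_add_right _ _)
  have hprod : ∀ v ≤ t, ∀ z, ‖z‖ ≤ ρ → ‖((v.map fun a => X - C a).prod).eval z‖ ≤ B := by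
    intro v hv z hz
    refine (norm_eval_prod_X_sub_C_le (fun b hb => htρ b (Multiset.mem_of_le hv hb))
      (B := 2 * ρ) (by linarith)).trans ?_
    exact pow_le_pow_right₀ (by linarith) ((Multiset.card_le_card hv).trans htcard)
  obtain ⟨Q, rem, hQ, hdiv, hdeg, hQle⟩ := exists_div_prod_X_sub_C t (by linarith) htρ
    (hG.sub g.differentiable) (δ := δ) (fun z hz => (hgG z (by linarith)).le)
  set T : ℂ[X] := (t.map fun a => X - C a).prod with hT
  have hN0 : (N : ℂ) ≠ 0 := by
    have : (N : ℝ) ≠ 0 := by linarith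
    exact_mod_cast this
  have hNn : ‖((N : ℂ))⁻¹‖ = (N : ℝ)⁻¹ := by simp
  have hNpos : (0 : ℝ) < N := by linarith
  have h2e : (2 : ℝ) ^ t.card * δ ≤ 2 ^ e * δ := by
    gcongr
    norm_num
  have hT0 : T ≠ 0 := (monic_multiset_prod_of_monic _ _ fun a _ => monic_X_sub_C a).ne_zero
  have hRρ : R' ≤ ρ := by linarith
  have hP'ev : ∀ z, ‖(C ((N : ℂ)⁻¹) * P * T).eval z‖ = (N : ℝ)⁻¹ * (‖P.eval z‖ * ‖T.eval z‖) := by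
    intro z
    rw [eval_mul, eval_mul, eval_C, norm_mul, norm_mul, hNn, mul_assoc]
  refine ⟨⟨f', C ((N : ℂ)⁻¹) * P * T, fun z => N * Q z, R', hf'mem, ?_, ?_, hQ.const_mul _,
    by linarith, by push_cast; linarith, ?_, ?_, ?_, ?_⟩, ?_, ?_, ?_⟩
  · refine mul_mem (mul_mem (C_mem_algebraicPolynomials ?_) hP)
      (prod_X_sub_C_mem_algebraicPolynomials htalg)
    exact (isAlgebraic_natCast (R := ℚ) (A := ℂ) N).inv
  · exact mul_ne_zero (mul_ne_zero (C_ne_zero.2 (inv_ne_zero hN0)) hP0) hT0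
  · intro k hk
    rcases Nat.lt_succ_iff_lt_or_eq.1 hk with h | rfl
    · simp [hPα k h]
    · have : T.eval (α k) = 0 := by
        rw [hT, ht, Multiset.map_add, Multiset.prod_add]
        simp
      simp [this]
  · intro k hk z hz
    -- `T` and `f' - α k` share the factor with roots `s k`; after cancelling it, a bounded product
    -- is compared with `u k`, which is bounded below.
    have h1 : T = ((s k).map fun a => X - C a).prod * ((t - s k).map fun a => X - C a).prod := by
      rw [hT, ← Multiset.prod_add, ← Multiset.map_add, add_tsub_cancel_of_le (hst k hk)]
    have h2 : f'.eval z - α k = (f' - C (α k)).eval z := by simp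
    have h3 := hprod (t - s k) tsub_le_self z (hz.trans hRρ)
    have h4 := hMP z (by linarith)
    have h5 := hule k hk z hz
    rw [hP'ev, h2, hsu k hk, h1, eval_mul, eval_mul, norm_mul, norm_mul]
    set p := ‖eval z (Multiset.map (fun a => X - C a) (s k)).prod‖
    have h6 : M * B ≤ N * (c / (2 * R') ^ D) := by
      rw [div_le_iff₀ hc] at hNM
      rw [mul_div_assoc', le_div_iff₀ (by positivity)]
      linarith
    rw [inv_mul_le_iff₀ hNpos]
    calc _ ≤ M * (p * B) := by gcongr
      _ = p * (M * B) := by ring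
      _ ≤ p * (N * (c / (2 * R') ^ D)) := by gcongr
      _ ≤ p * (N * ‖(u k).eval z‖) := by gcongr
      _ = _ := by ring
  · intro z hz
    rw [norm_mul, Complex.norm_natCast]
    calc (N : ℝ) * ‖Q z‖ ≤ N * (2 ^ t.card * δ) := by
          gcongr
          exact hQle z (by linarith)
      _ ≤ N * (2 ^ e * δ) := by gcongr
      _ = δ * (2 ^ e * N) := by ring
      _ ≤ _ := hd4
  · intro n
    -- The factors `N` cancel, so the series changes exactly by the polynomial `P * rem`, of degree
    -- at most `P.natDegree + e`.
    have h1 : (fun z => f'.eval z + (C ((N : ℂ)⁻¹) * P * T).eval z * (N * Q z))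
        = fun z => F z - (P * rem).eval z := by
      ext z
      have h2 := hdiv z
      simp only [Pi.sub_apply] at h2
      simp only [hf', hF, eval_add, eval_mul, eval_C]
      field_simp
      linear_combination (-P.eval z) * h2
    rw [h1, taylorCoeff_sub hFd (P * rem).differentiable, Polynomial.taylorCoeff_eval]
    have h3 : ‖(P * rem).coeff n‖ ≤ θ n * (1 / 2) ^ (m + 1) := by
      by_cases hn : n ≤ P.natDegree + e
      · have hb : ∀ z, ‖z‖ = 1 → ‖(P * rem).eval z‖ ≤ δ * (M * (1 + B * 2 ^ e)) := by
          intro z hz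
          have h4 : rem.eval z = (G z - g.eval z) - T.eval z * Q z := by
            have h2 := hdiv z
            simp only [Pi.sub_apply] at h2
            rw [h2]; ring
          have h5 := hMP z (by linarith)
          have h6 := hgG z (by linarith)
          have h7 := hprod t le_rfl z (by linarith)
          have h8 := hQle z (by linarith)
          rw [eval_mul, norm_mul, h4]
          calc _ ≤ M * (‖G z - g.eval z‖ + ‖T.eval z * Q z‖) := by
                gcongr
                exact norm_sub_le _ _
            _ ≤ M * (δ + B * (2 ^ e * δ)) := by
                rw [norm_mul]
                gcongr
                exact h8.trans h2e
            _ = _ := by ring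
        have h9 := norm_taylorCoeff_le (P * rem).differentiable one_pos hb n
        rw [Polynomial.taylorCoeff_eval, one_pow, div_one] at h9
        refine h9.trans (hd5.trans ?_)
        gcongr
        exact hμθ n hn
      · rw [coeff_eq_zero_of_natDegree_lt, norm_zero]
        · have := hθ n
          positivity
        · refine natDegree_mul_le.trans_lt ?_
          omega
    have h10 := hcoeff n
    calc ‖taylorCoeff F n - (P * rem).coeff n - a n‖
        = ‖(taylorCoeff F n - a n) - (P * rem).coeff n‖ := by congr 1; ring
      _ ≤ _ := norm_sub_le _ _
      _ ≤ θ n * (1 - (1 / 2) ^ m) + θ n * (1 / 2) ^ (m + 1) := add_le_add h10 h3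
      _ = _ := by ring
  · change R ≤ R'
    linarith
  · intro z hz
    change ‖z‖ ≤ R at hz
    change ‖(C ((N : ℂ)⁻¹) * P * T).eval z‖ ≤ ‖P.eval z‖
    have h7 := hprod t le_rfl z (by linarith)
    rw [hP'ev, inv_mul_le_iff₀ hNpos, mul_comm]
    gcongr
    exact h7.trans hNB
  · intro z hz
    change ‖z‖ ≤ R at hz
    change ‖f'.eval z - f.eval z‖ ≤ ‖P.eval z‖ * (1 / 2) ^ (m + 2)
    have h1 : f'.eval z - f.eval z = P.eval z * g.eval z := by simp [hf']
    rw [h1, norm_mul]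
    gcongr
    have h2 := hgG z (by linarith)
    have h3 := hGle z hz
    have h4 : ‖g.eval z‖ ≤ ‖G z‖ + ‖G z - g.eval z‖ := by
      have := norm_sub_le (G z) (G z - g.eval z)
      simpa using this
    calc ‖g.eval z‖ ≤ (1 / 2) ^ (m + 3) + (1 / 2) ^ (m + 3) := by linarith
      _ = _ := by ring

/-! ### Transcendence -/

lemma Polynomial.norm_eval_le_of_one_le_norm (p : ℂ[X]) {K : ℕ} (hK : p.natDegree ≤ K) {z : ℂ}
    (hz : 1 ≤ ‖z‖) :
    ‖p.eval z‖ ≤ (∑ i ∈ Finset.range (p.natDegree + 1), ‖p.coeff i‖) * ‖z‖ ^ K := by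
  rw [eval_eq_sum_range, Finset.sum_mul]
  refine norm_sum_le_of_le _ fun i hi => ?_
  rw [norm_mul, norm_pow]
  have : i ≤ K := by have := Finset.mem_range.1 hi; omega
  gcongr

lemma Polynomial.exists_pos_le_norm_eval (p : ℂ[X]) (hp : p ≠ 0) :
    ∃ c > 0, ∃ r : ℝ, ∀ z, r ≤ ‖z‖ → c ≤ ‖p.eval z‖ := by
  rcases Nat.eq_zero_or_pos p.natDegree with h | h
  · rw [eq_C_of_natDegree_eq_zero h] at hp ⊢
    exact ⟨_, norm_pos_iff.2 (C_ne_zero.1 hp), 0, fun z _ => by simp⟩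
  · have h1 := p.tendsto_norm_atTop (natDegree_pos_iff_degree_pos.1 h)
      (tendsto_norm_cobounded_atTop (E := ℂ))
    have h2 := h1.eventually_ge_atTop 1
    rw [← comap_norm_atTop, eventually_comap] at h2
    obtain ⟨r, hr⟩ := eventually_atTop.1 h2
    exact ⟨1, one_pos, r, fun z hz => hr _ hz z rfl⟩

/-- An algebraic entire function has polynomial growth, so almost all of its Taylor coefficients
vanish. -/
lemma exists_taylorCoeff_eq_zero_of_algebraic {f : ℂ → ℂ} (hf : Differentiable ℂ f)
    {q : ℂ[X][X]} (hq : q ≠ 0) (h : ∀ z, q.evalEval z (f z) = 0) : ∃ n, taylorCoeff f n = 0 := by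
  obtain ⟨c, hc, r, hr⟩ := Polynomial.exists_pos_le_norm_eval _ (leadingCoeff_ne_zero.2 hq)
  set d := q.natDegree with hd
  set K := ∑ i ∈ Finset.range d, (q.coeff i).natDegree with hK
  set M := ∑ i ∈ Finset.range d,
    ∑ j ∈ Finset.range ((q.coeff i).natDegree + 1), ‖(q.coeff i).coeff j‖ with hM
  have hM0 : 0 ≤ M := Finset.sum_nonneg fun _ _ => Finset.sum_nonneg fun _ _ => norm_nonneg _
  have hbound : ∀ z, 1 ≤ ‖z‖ → r ≤ ‖z‖ → ‖f z‖ ≤ (1 + M / c) * ‖z‖ ^ K := by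
    intro z hz1 hzr
    have hzK : 1 ≤ ‖z‖ ^ K := one_le_pow₀ hz1
    have hMc : 0 ≤ M / c := by positivity
    rcases le_or_gt ‖f z‖ 1 with hy | hy
    · nlinarith
    have h0 := h z
    rw [← map_evalRingHom_eval, eval_map, eval₂_eq_sum_range, Finset.sum_range_succ] at h0
    simp only [coe_evalRingHom] at h0
    -- As `‖f z‖ > 1`, all lower powers of `f z` are at most `‖f z‖ ^ (d - 1)`, which is then
    -- divided out.
    have h1 : ‖q.leadingCoeff.eval z * f z ^ d‖ ≤ M * ‖z‖ ^ K * ‖f z‖ ^ (d - 1) := by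
      rw [← hd, add_comm, add_eq_zero_iff_eq_neg] at h0
      change (q.leadingCoeff.eval z * f z ^ d) = _ at h0
      rw [h0, norm_neg, hM, Finset.sum_mul, Finset.sum_mul]
      refine norm_sum_le_of_le _ fun i hi => ?_
      rw [norm_mul, norm_pow]
      have hi' := Finset.mem_range.1 hi
      gcongr
      · refine Polynomial.norm_eval_le_of_one_le_norm _ ?_ hz1
        exact Finset.single_le_sum (f := fun i => (q.coeff i).natDegree)
          (fun _ _ => Nat.zero_le _) hi
      · exact hy.le
      · omega
    have hpos : 0 < ‖f z‖ ^ (d - 1) := by positivity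
    rw [norm_mul, norm_pow] at h1
    have hcz := hr z hzr
    rcases Nat.eq_zero_or_pos d with h2 | h2
    · exfalso
      have hM' : M = 0 := by simp [hM, h2]
      rw [hM', h2] at h1
      simp at h1
      rw [h1, norm_zero] at hcz
      linarith
    · have h3 : ‖f z‖ ^ d = ‖f z‖ * ‖f z‖ ^ (d - 1) := by
        rw [← pow_succ']; congr 1; omega
      rw [h3, ← mul_assoc] at h1
      have h4 := le_of_mul_le_mul_right h1 hpos
      have h5 : ‖f z‖ ≤ M / c * ‖z‖ ^ K := by
        rw [div_mul_eq_mul_div, le_div_iff₀ hc]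
        calc ‖f z‖ * c ≤ ‖f z‖ * ‖q.leadingCoeff.eval z‖ := by gcongr
          _ ≤ _ := by linarith
      nlinarith
  refine ⟨K + 1, ?_⟩
  have hlim : Tendsto (fun R : ℝ => (1 + M / c) / R) atTop (𝓝 0) :=
    tendsto_const_nhds.div_atTop tendsto_id
  rw [← norm_le_zero_iff]
  refine ge_of_tendsto hlim ?_
  filter_upwards [eventually_ge_atTop 1, eventually_ge_atTop r] with R hR1 hRr
  have hR0 : 0 < R := by linarith
  refine (norm_taylorCoeff_le hf hR0 (C := (1 + M / c) * R ^ K) (fun z hz => ?_) _).trans_eq ?_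
  · have := hbound z (by linarith) (by linarith)
    rwa [hz] at this
  · rw [pow_succ]
    field_simp

lemma EntireFunction.isTranscendental_of_coeff_ne_zero (f : EntireFunction)
    (hf : ∀ n, f.coeff n ≠ 0) : f.IsTranscendental := by
  intro P hP
  by_contra h0
  have h1 : (Polynomial.Bivariate.equivMvPolynomial ℂ).symm P ≠ 0 := by simpa using h0
  have hev : ∀ x y : ℂ, ((Polynomial.Bivariate.equivMvPolynomial ℂ).symm P).evalEval x y
      = MvPolynomial.eval ![x, y] P := by
    intro x y
    have h : (evalEvalRingHom x y).comp
        ((Polynomial.Bivariate.equivMvPolynomial ℂ).symm : MvPolynomial (Fin 2) ℂ →+* ℂ[X][X])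
        = MvPolynomial.eval ![x, y] := by
      refine MvPolynomial.ringHom_ext (fun a => by simp) fun i => ?_
      fin_cases i <;> simp
    exact RingHom.congr_fun h P
  obtain ⟨n, hn⟩ := exists_taylorCoeff_eq_zero_of_algebraic f.differentiable h1
    fun z => by rw [hev, hP]
  exact hf n hn

/-! ### Passage to the limit -/

/-- The limit of a sequence of successive refinements. -/
lemma exists_limit_of_refines {α a : ℕ → ℂ} {θ : ℕ → ℝ} (s : ∀ m, MahlerStage α a θ m)
    (hs : ∀ m, (s m).Refines (s (m + 1))) (hα : ∀ k, α k ∈ algebraicNumbers) :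
    ∃ f : ℂ → ℂ, Differentiable ℂ f ∧ (∀ n, ‖taylorCoeff f n - a n‖ ≤ θ n) ∧
      ∀ k, f (α k) ∈ algebraicNumbers ∧ ∀ z, f z = α k → z ∈ algebraicNumbers := by
  have hR : Monotone fun m => (s m).R := monotone_nat_of_le_succ fun m => (hs m).R_le
  have hP : ∀ m j, m ≤ j → ∀ z, ‖z‖ ≤ (s m).R → ‖(s j).P.eval z‖ ≤ ‖(s m).P.eval z‖ := by
    intro m j hmj z hz
    induction j, hmj using Nat.le_induction with
    | base => exact le_rfl
    | succ j hj ih => exact ((hs j).P_le z (hz.trans (hR hj))).trans ih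
  have hf : ∀ m j, m ≤ j → ∀ z, ‖z‖ ≤ (s m).R → ‖(s j).f.eval z - (s m).f.eval z‖ ≤
      ‖(s m).P.eval z‖ * ((1 / 2) ^ (m + 1) - (1 / 2) ^ (j + 1)) := by
    intro m j hmj z hz
    induction j, hmj using Nat.le_induction with
    | base => simp
    | succ j hj ih =>
      have h1 := (hs j).f_le z (hz.trans (hR hj))
      have h2 := hP m j hj z hz
      calc _ ≤ ‖(s (j + 1)).f.eval z - (s j).f.eval z‖ + ‖(s j).f.eval z - (s m).f.eval z‖ :=
            norm_sub_le_norm_sub_add_norm_sub _ _ _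
        _ ≤ ‖(s m).P.eval z‖ * (1 / 2) ^ (j + 2) + _ := by
            refine add_le_add (h1.trans ?_) ih
            gcongr
        _ = _ := by ring
  have hf' : ∀ m j, m ≤ j → ∀ z, ‖z‖ ≤ (s m).R → ‖(s j).f.eval z - (s m).f.eval z‖ ≤
      ‖(s m).P.eval z‖ * (1 / 2) ^ (m + 1) := by
    intro m j hmj z hz
    refine (hf m j hmj z hz).trans ?_
    gcongr
    have : (0 : ℝ) < (1 / 2) ^ (j + 1) := by positivity
    linarith
  have hex : ∀ z : ℂ, ∀ N : ℕ, ∃ m, N ≤ m ∧ ‖z‖ ≤ (s m).R := by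
    intro z N
    obtain ⟨k, hk⟩ := exists_nat_ge ‖z‖
    refine ⟨max N k, le_max_left _ _, hk.trans (le_trans ?_ (s (max N k)).le_R)⟩
    exact_mod_cast le_max_right _ _
  have hhalf : Tendsto (fun m : ℕ => (1 / 2 : ℝ) ^ m) atTop (𝓝 0) :=
    tendsto_pow_atTop_nhds_zero_of_lt_one (by norm_num) (by norm_num)
  have hhalf' : Tendsto (fun m : ℕ => (1 / 2 : ℝ) ^ (m + 1)) atTop (𝓝 0) :=
    (tendsto_add_atTop_iff_nat 1).2 hhalf
  have hlim : ∀ z, ∃ w, Tendsto (fun m => (s m).f.eval z) atTop (𝓝 w) := by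
    intro z
    obtain ⟨M, -, hM⟩ := hex z 0
    refine cauchySeq_tendsto_of_complete (Metric.cauchySeq_iff'.2 fun ε hε => ?_)
    have h1 : Tendsto (fun m : ℕ => ‖(s M).P.eval z‖ * (1 / 2 : ℝ) ^ (m + 1)) atTop (𝓝 0) := by
      simpa using hhalf'.const_mul ‖(s M).P.eval z‖
    obtain ⟨m, hm, hmM⟩ := ((h1.eventually_lt_const hε).and (eventually_ge_atTop M)).exists
    refine ⟨m, fun j hj => ?_⟩
    rw [dist_eq_norm]
    refine ((hf' m j hj z (hM.trans (hR hmM))).trans ?_).trans_lt hm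
    gcongr
    exact hP M m hmM z hM
  choose f hflim using hlim
  have hfm : ∀ m z, ‖z‖ ≤ (s m).R →
      ‖f z - (s m).f.eval z‖ ≤ ‖(s m).P.eval z‖ * (1 / 2) ^ (m + 1) := by
    intro m z hz
    refine le_of_tendsto ((hflim z).sub_const _).norm ?_
    filter_upwards [eventually_ge_atTop m] with j hj using hf' m j hj z hz
  have hdiff : Differentiable ℂ f := by
    intro z
    obtain ⟨M, -, hM⟩ := hex (‖z‖ + 1 : ℝ) 0
    have hM' : ‖z‖ + 1 ≤ (s M).R := by
      rwa [Complex.norm_real, Real.norm_of_nonneg (by positivity)] at hM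
    obtain ⟨B, hB0, hB⟩ := exists_norm_le_of_differentiable (s M).P.differentiable (s M).R
    have hu : TendstoUniformlyOn (fun m z => (s m).f.eval z) f atTop (ball 0 (‖z‖ + 1)) := by
      rw [Metric.tendstoUniformlyOn_iff]
      intro ε hε
      have h1 : Tendsto (fun m : ℕ => B * (1 / 2 : ℝ) ^ (m + 1)) atTop (𝓝 0) := by
        simpa using hhalf'.const_mul B
      filter_upwards [h1.eventually_lt_const hε, eventually_ge_atTop M] with m hm hmM w hw
      have hw' : ‖w‖ ≤ (s M).R := by
        have := mem_ball_zero_iff.1 hw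
        linarith
      rw [dist_eq_norm]
      refine ((hfm m w (hw'.trans (hR hmM))).trans ?_).trans_lt hm
      gcongr
      exact (hP M m hmM w hw').trans (hB w hw')
    have hd := hu.tendstoLocallyUniformlyOn.differentiableOn
      (Eventually.of_forall fun m => (s m).f.differentiable.differentiableOn) isOpen_ball
    exact hd.differentiableAt (isOpen_ball.mem_nhds (by simp))
  refine ⟨f, hdiff, fun n => ?_, fun k => ⟨?_, fun z hz => ?_⟩⟩
  -- Cauchy's estimate on the unit circle, which lies in every disk; there all the `P` are bounded
  -- by `B`, since their norms decrease from stage 0.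
  · obtain ⟨B, hB0, hB⟩ := exists_norm_le_of_differentiable (s 0).P.differentiable (s 0).R
    have hlim : Tendsto (fun m : ℕ => 2 * B * (1 / 2 : ℝ) ^ m + θ n * (1 - (1 / 2 : ℝ) ^ m)) atTop
        (𝓝 (2 * B * 0 + θ n * (1 - 0))) :=
      (hhalf.const_mul _).add ((hhalf.const_sub 1).const_mul _)
    simp only [mul_zero, sub_zero, mul_one, zero_add] at hlim
    refine ge_of_tendsto' hlim fun m => ?_
    have hFd : Differentiable ℂ fun z => (s m).f.eval z + (s m).P.eval z * (s m).G z :=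
      (s m).f.differentiable.add ((s m).P.differentiable.mul (s m).G_diff)
    have h1 : ‖taylorCoeff f n -
        taylorCoeff (fun z => (s m).f.eval z + (s m).P.eval z * (s m).G z) n‖
        ≤ 2 * B * (1 / 2 : ℝ) ^ m := by
      rw [← taylorCoeff_sub hdiff hFd]
      have h2 := norm_taylorCoeff_le (hdiff.sub hFd) one_pos (C := 2 * B * (1 / 2 : ℝ) ^ m)
        (fun z hz => ?_) n
      · rwa [one_pow, div_one] at h2
      have hz0 : ‖z‖ ≤ (s 0).R := by rw [hz]; exact (s 0).one_le_R
      have hzm : ‖z‖ ≤ (s m).R := by rw [hz]; exact (s m).one_le_R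
      have h3 := hfm m z hzm
      have h4 := (s m).norm_G_le z hzm
      have h5 : ‖(s m).P.eval z‖ ≤ B := (hP 0 m (Nat.zero_le _) z hz0).trans (hB z hz0)
      have h6 : (1 / 2 : ℝ) ^ (m + 1) ≤ (1 / 2) ^ m :=
        pow_le_pow_of_le_one (by norm_num) (by norm_num) (by omega)
      have h7 : (1 / 2 : ℝ) ^ (m + 3) ≤ (1 / 2) ^ m :=
        pow_le_pow_of_le_one (by norm_num) (by norm_num) (by omega)
      calc ‖f z - ((s m).f.eval z + (s m).P.eval z * (s m).G z)‖
          = ‖(f z - (s m).f.eval z) - (s m).P.eval z * (s m).G z‖ := by congr 1; ring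
        _ ≤ ‖f z - (s m).f.eval z‖ + ‖(s m).P.eval z‖ * ‖(s m).G z‖ := by
            rw [← norm_mul]; exact norm_sub_le _ _
        _ ≤ B * (1 / 2) ^ m + B * (1 / 2) ^ m := by
            refine add_le_add (h3.trans ?_) ?_
            · gcongr
            · gcongr
              exact h4.trans h7
        _ = _ := by ring
    exact (norm_sub_le_norm_sub_add_norm_sub _ _ _).trans (add_le_add h1 ((s m).coeff_le n))
  · obtain ⟨m, hkm, hm⟩ := hex (α k) (k + 1)
    have h1 := hfm m (α k) hm
    rw [(s m).eval_P k (by omega), norm_zero, zero_mul, norm_le_zero_iff, sub_eq_zero] at h1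
    rw [h1]
    exact eval_mem_algebraicNumbers (s m).f_mem (hα k)
  · obtain ⟨m, hkm, hm⟩ := hex z (k + 1)
    have h1 := hfm m z hm
    have h2 := (s m).norm_P_le k (by omega) z hm
    rw [hz, norm_sub_rev] at h1
    have h3 : (1 / 2 : ℝ) ^ (m + 1) ≤ (1 / 2) ^ 1 :=
      pow_le_pow_of_le_one (by norm_num) (by norm_num) (by omega)
    -- Here `‖P z‖ ≤ ‖f_m z - α k‖ ≤ ‖P z‖ / 2`, with `f_m` the polynomial of stage `m`, which
    -- forces `P z = 0`.
    refine mem_algebraicNumbers_of_eval_eq_zero (s m).P_mem (s m).P_ne_zero ?_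
    rw [← norm_le_zero_iff]
    nlinarith [norm_nonneg ((s m).P.eval z)]

/-- Every entire function with non-zero linear term is approximated, coefficient by coefficient,
by entire functions preserving algebraicity in both directions. -/
lemma exists_entire_preserving_algebraicNumbers {F : ℂ → ℂ} (hF : Differentiable ℂ F)
    {θ : ℕ → ℝ} (hθ : ∀ n, 0 < θ n) (hθF : θ 1 ≤ ‖taylorCoeff F 1‖) :
    ∃ f : ℂ → ℂ, Differentiable ℂ f ∧ (∀ n, ‖taylorCoeff f n - taylorCoeff F n‖ ≤ θ n) ∧
      f '' algebraicNumbers ⊆ algebraicNumbers ∧ f ⁻¹' algebraicNumbers ⊆ algebraicNumbers := by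
  obtain ⟨α, hα⟩ := exists_range_eq_algebraicNumbers
  have hα' : ∀ k, α k ∈ algebraicNumbers := fun k => hα ▸ Set.mem_range_self k
  obtain ⟨B, hB0, hB⟩ := exists_norm_le_of_differentiable hF 1
  obtain ⟨N, hN⟩ := exists_nat_ge (8 * B)
  have hN0 : 0 < (N : ℝ) := by linarith
  have hNc : (N : ℂ) ≠ 0 := by
    have := hN0.ne'
    exact_mod_cast this
  -- The trivial splitting `F = 0 + N * (F / N)`; `N ≥ 8 * B` yields the required bound `(1 / 2) ^
  -- 3` on the unit disk.
  let s0 : MahlerStage α (taylorCoeff F) θ 0 :=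
    { f := 0
      P := C (N : ℂ)
      G := fun z => (N : ℂ)⁻¹ * F z
      R := 1
      f_mem := zero_mem _
      P_mem := C_mem_algebraicPolynomials (isAlgebraic_natCast (R := ℚ) (A := ℂ) N)
      P_ne_zero := C_ne_zero.2 hNc
      G_diff := hF.const_mul _
      one_le_R := le_rfl
      le_R := by simp
      eval_P := by simp
      norm_P_le := by simp
      norm_G_le := fun z hz => by
        rw [norm_mul, norm_inv, Complex.norm_natCast, inv_mul_le_iff₀ hN0]
        have := hB z hz
        norm_num
        linarith
      coeff_le := fun n => by simp [mul_inv_cancel_left₀ hNc] }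
  choose next hnext using fun (m : ℕ) (s : MahlerStage α (taylorCoeff F) θ m) =>
    s.exists_refines hα' hθ hθF
  let s : ∀ m, MahlerStage α (taylorCoeff F) θ m := fun m => Nat.rec s0 next m
  obtain ⟨f, hfd, hfc, hfα⟩ := exists_limit_of_refines s (fun m => hnext m (s m)) hα'
  refine ⟨f, hfd, hfc, ?_, fun z hz => ?_⟩
  · rintro _ ⟨z, hz, rfl⟩
    rw [← hα] at hz
    obtain ⟨k, rfl⟩ := hz
    exact (hfα k).1
  · rw [Set.mem_preimage, ← hα] at hz
    obtain ⟨k, hk⟩ := hz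
    exact (hfα k).2 z hk.symm

/-! ### The topology and density -/

/-- The sets `V_{g,θ}` with centre `g` form a neighbourhood basis of `g`. -/
lemma EntireFunction.exists_basicOpen_subset {U : Set EntireFunction} (hU : IsOpen U)
    {g : EntireFunction} (hg : g ∈ U) :
    ∃ θ : ℕ → ℝ, (∀ n, 0 < θ n) ∧ g.basicOpen θ ⊆ U := by
  induction hU with
  | basic V hV =>
    obtain ⟨g', θ, hθ, rfl⟩ := hV
    refine ⟨fun n => θ n - ‖g'.coeff n - g.coeff n‖, fun n => sub_pos.2 (hg n), fun h hh n => ?_⟩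
    have h1 := hh n
    have h2 := norm_sub_le_norm_sub_add_norm_sub (g'.coeff n) (g.coeff n) (h.coeff n)
    linarith
  | univ => exact ⟨1, by simp, Set.subset_univ _⟩
  | inter V W _ _ hV hW =>
    obtain ⟨θ, hθ, hθV⟩ := hV hg.1
    obtain ⟨η, hη, hηW⟩ := hW hg.2
    refine ⟨fun n => min (θ n) (η n), fun n => lt_min (hθ n) (hη n), fun h hh =>
      ⟨hθV fun n => (hh n).trans_le (min_le_left _ _),
        hηW fun n => (hh n).trans_le (min_le_right _ _)⟩⟩
  | sUnion S _ ih =>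
    obtain ⟨V, hV, hgV⟩ := hg
    obtain ⟨θ, hθ, hθV⟩ := ih V hV hgV
    exact ⟨θ, hθ, hθV.trans (Set.subset_sUnion_of_mem hV)⟩

theorem mainTheorem2 : Dense {f : EntireFunction | f.IsMahler} := by
  rw [dense_iff_inter_open]
  rintro U hU ⟨g, hg⟩
  obtain ⟨θ, hθ, hθU⟩ := EntireFunction.exists_basicOpen_subset hU hg
  have hη : ∀ n : ℕ, 0 < min (θ n / 2) (1 / n.factorial) := fun n =>
    lt_min (half_pos (hθ n)) (by positivity)
  classical
  -- `E` fills in the vanishing coefficients of `g`: the bound `1 / n!` makes it entire, `θ n / 2`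
  -- keeps `g + E` near `g`.
  obtain ⟨E, hE, hEc⟩ := exists_entire_taylorCoeff_eq
    (fun n => if g.coeff n = 0 then ((min (θ n / 2) (1 / n.factorial) : ℝ) : ℂ) else 0) (by
      intro n
      split_ifs
      · rw [Complex.norm_real, Real.norm_of_nonneg (hη n).le]
        exact min_le_right _ _
      · rw [norm_zero]
        positivity)
  set F : ℂ → ℂ := fun z => g.toFun z + E z with hFdef
  have hF : Differentiable ℂ F := g.differentiable.add hE
  have hFc : ∀ n, taylorCoeff F n = g.coeff n + taylorCoeff E n :=
    fun n => taylorCoeff_add g.differentiable hE n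
  have hF0 : ∀ n, 0 < ‖taylorCoeff F n‖ := by
    intro n
    rw [norm_pos_iff, hFc, hEc]
    split_ifs with h
    · rw [h, zero_add, Complex.ofReal_ne_zero]
      exact (hη n).ne'
    · rwa [add_zero]
  have hEθ : ∀ n, ‖taylorCoeff E n‖ ≤ θ n / 2 := by
    intro n
    rw [hEc]
    split_ifs
    · rw [Complex.norm_real, Real.norm_of_nonneg (hη n).le]
      exact min_le_left _ _
    · rw [norm_zero]
      exact (half_pos (hθ n)).le
  obtain ⟨f, hf, hfc, him, hpre⟩ := exists_entire_preserving_algebraicNumbers hF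
    -- The first bound keeps the total error at most `3 * θ n / 4`; the second keeps every
    -- coefficient nonzero and supplies the condition on the linear term.
    (θ := fun n => min (θ n / 4) (‖taylorCoeff F n‖ / 2))
    (fun n => lt_min (by have := hθ n; positivity) (half_pos (hF0 n)))
    ((min_le_right _ _).trans (by linarith [hF0 1]))
  let f' : EntireFunction := ⟨f, hf⟩
  refine ⟨f', hθU fun n => ?_, f'.isTranscendental_of_coeff_ne_zero fun n => ?_, him, hpre⟩
  · change ‖g.coeff n - taylorCoeff f n‖ < θ n
    have h1 := (hfc n).trans (min_le_left _ _)
    have h2 : g.coeff n - taylorCoeff f n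
        = -(taylorCoeff f n - taylorCoeff F n) - taylorCoeff E n := by rw [hFc]; ring
    have h3 := norm_sub_le (-(taylorCoeff f n - taylorCoeff F n)) (taylorCoeff E n)
    rw [norm_neg] at h3
    rw [h2]
    linarith [hEθ n, hθ n]
  · intro h
    change taylorCoeff f n = 0 at h
    have h1 := (hfc n).trans (min_le_right _ _)
    rw [h, zero_sub, norm_neg] at h1
    linarith [hF0 n]
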